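/- Position-based model. Let $1\le L\le K$ be integers, and let $1\ge \kappa_1>\dots>\kappa_L>0$ be fixed examination probabilities, known to the learner. A parameter is a vector $\theta\in(0,1)^K$. An action is an ordered list $a=(a_1,\dots,a_L)$ of $L$ distinct arms from $\{1,\dots,K\}$. When an action $a$ is played, the learner observes $Z=(X_1Y_1,\dots,X_LY_L)$, where the variables $Y_l\sim\mathrm{Bernoulli}(\kappa_l)$ and $X_l\sim\mathrm{Bernoulli}(\theta_{a_l})$, $1\le l\le L$, are all independent, and receives the reward $\sum_{l=1}^L Z_l$. A (possibly randomized) algorithm chooses, for every $t\ge 1$, the action $A(t)$ as a function of the past actions and observations; given the action, the observation of each round is independent of the past. Write $\mu_a(\theta)=\sum_{l=1}^L\kappa_l\theta_{a_l}$, $\mu^*(\theta)=\max_a\mu_a(\theta)$, $\Delta_a(\theta)=\mu^*(\theta)-\mu_a(\theta)$, and let $\mathbb{E}_\theta[R(T)]=T\mu^*(\theta)-\mathbb{E}_\theta\big[\sum_{t=1}^T\sum_{l=1}^L Z_l(t)\big]$ be the expected regret after $T$ rounds. The algorithm is uniformly efficient if $\mathbb{E}_\theta[R(T)]=o(T^\alpha)$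 as $T\to\infty$ for every $\theta\in(0,1)^K$ and every $\alpha\in(0,1]$. Let $d(p,q)=p\log\frac pq+(1-p)\log\frac{1-p}{1-q}$. Theorem. For every uniformly efficient algorithm and every $\theta\in(0,1)^K$ with $\theta_1>\dots>\theta_K$, $$\liminf_{T\to\infty}\frac{\mathbb{E}_\theta[R(T)]}{\log T}\;\ge\;\sum_{k=L+1}^K\;\min_{1\le l\le L}\;\frac{\Delta_{v_{k,l}}(\theta)}{d(\kappa_l\theta_k,\kappa_l\theta_L)},$$ where $v_{k,l}=(1,\dots,l-1,k,l,\dots,L-1)$. -/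

import Mathlib

open Filter Asymptotics
open scoped ENNReal

namespace PBM

/-- The parameter space `Θ = (0,1)^K` of the arm expectations. -/
abbrev Param (K : ℕ) := Fin K → Set.Ioo (0 : ℝ) 1

/-- The examination probabilities, one in `(0,1]` for each of the `L` positions. -/
abbrev Exam (L : ℕ) := Fin L → Set.Ioc (0 : ℝ) 1

/-- An action: an ordered list of `L` distinct arms (arms and positions are numbered from `0`). -/
abbrev Action (K L : ℕ) := Fin L ↪ Fin K

/-- A vector of binary (censored) observations, one for each position. -/
abbrev Obs (L : ℕ) := Fin L → Bool

/-- What the learner has seen after `t` rounds: the actions played and the observations. -/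
abbrev History (K L t : ℕ) := Fin t → Action K L × Obs L

/-- A (possibly randomized) algorithm: the conditional law of the next action given the
actions and observations of the `t` past rounds. -/
def Policy (K L : ℕ) := (t : ℕ) → History K L t → PMF (Action K L)

/-- The Bernoulli law with parameter `p`. -/
noncomputable def bern (p : Set.Icc (0 : ℝ) 1) : PMF Bool :=
  PMF.ofFintype (fun b => ENNReal.ofReal (if b then (p : ℝ) else 1 - (p : ℝ))) (by
    rw [Fintype.sum_bool, ← ENNReal.ofReal_add]
    · simp
    · simpa using p.2.1
    · simpa using p.2.2)

/-- The law of a vector of independent Boolean variables with given marginals. -/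
noncomputable def indep {n : ℕ} (p : Fin n → PMF Bool) : PMF (Fin n → Bool) :=
  PMF.ofFintype (fun z => ∏ i, p i (z i)) (by
    rw [← Fintype.prod_sum (fun i b => p i b)]
    refine Finset.prod_eq_one fun i _ => ?_
    rw [← tsum_fintype (L := .unconditional _)]
    exact (p i).tsum_coe)

/-- The law of the observation `Z` when action `a` is played: `Z_l = X_l Y_l` with all the
`Y_l ∼ Bernoulli(κ_l)` and `X_l ∼ Bernoulli(θ_{a_l})` independent. -/
noncomputable def feedback {K L : ℕ} (κ : Exam L) (θ : Param K) (a : Action K L) : PMF (Obs L) :=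
  (indep fun l => bern ⟨κ l, (κ l).2.1.le, (κ l).2.2⟩).bind fun y =>
    (indep fun l => bern ⟨θ (a l), (θ (a l)).2.1.le, (θ (a l)).2.2.le⟩).map fun x =>
      fun l => x l && y l

/-- The law, under parameter `θ`, of the history of the first `T` rounds of the interaction
of the algorithm `π` with the model. -/
noncomputable def historyLaw {K L : ℕ} (κ : Exam L) (θ : Param K) (π : Policy K L) :
    (T : ℕ) → PMF (History K L T)
  | 0 => PMF.pure Fin.elim0
  | T + 1 => (historyLaw κ θ π T).bind fun h =>
      (π T h).bind fun a => (feedback κ θ a).map fun z => Fin.snoc h (a, z)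

/-- The reward `r = ∑_l Z_l` of one round. -/
def reward {L : ℕ} (z : Obs L) : ℝ := ∑ l, if z l then 1 else 0

/-- The expected reward `μ_a(θ) = ∑_l κ_l θ_{a_l}` of action `a`. -/
def meanReward {K L : ℕ} (κ : Exam L) (θ : Param K) (a : Action K L) : ℝ :=
  ∑ l, (κ l : ℝ) * (θ (a l) : ℝ)

/-- The best expected reward `μ^*(θ)`, a maximum over the finitely many actions. -/
noncomputable def bestReward {K : ℕ} (L : ℕ) (κ : Exam L) (θ : Param K) : ℝ :=
  ⨆ a : Action K L, meanReward κ θ a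

/-- The gap `Δ_a(θ) = μ^*(θ) - μ_a(θ)`. -/
noncomputable def gap {K L : ℕ} (κ : Exam L) (θ : Param K) (a : Action K L) : ℝ :=
  bestReward L κ θ - meanReward κ θ a

/-- The expected regret `E_θ[R(T)]`: `T` times the best expected reward, minus the expectation
of the sum of the rewards collected in the first `T` rounds. -/
noncomputable def expectedRegret {K L : ℕ} (κ : Exam L) (θ : Param K) (π : Policy K L)
    (T : ℕ) : ℝ :=
  T * bestReward L κ θ -
    ∑ h : History K L T, (historyLaw κ θ π T h).toReal * ∑ t, reward (h t).2

/-- For every parameter `θ ∈ (0,1)^K` and every `α ∈ (0,1]`, the expected regret is `o(T^α)`.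
The examination probabilities are fixed: the learner knows them. -/
def UniformlyEfficient {K L : ℕ} (κ : Exam L) (π : Policy K L) : Prop :=
  ∀ θ : Param K, ∀ α : ℝ, 0 < α → α ≤ 1 →
    (fun T : ℕ => expectedRegret κ θ π T) =o[atTop] (fun T : ℕ => (T : ℝ) ^ α)

/-- The Kullback-Leibler divergence `d(p,q)` from `Bernoulli(p)` to `Bernoulli(q)`. -/
noncomputable def kl (p q : ℝ) : ℝ :=
  p * Real.log (p / q) + (1 - p) * Real.log ((1 - p) / (1 - q))

/-- The list `v_{k,l}`: arm `k`, not among the first `L` arms, is inserted at position `l` of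
the list of the first `L` arms, the arms from position `l` on are shifted by one position, and
the last one is dropped. -/
def insertArm {K L : ℕ} (k : {k : Fin K // L ≤ (k : ℕ)}) (l : Fin L) : Action K L where
  toFun j :=
    if j < l then ⟨j, by have := k.1.2; have := k.2; have := j.2; omega⟩
    else if j = l then k.1
    else ⟨(j : ℕ) - 1, by have := k.1.2; have := k.2; have := j.2; omega⟩
  inj' := by
    intro i j h
    have hk := k.2
    have hi := i.2
    have hj := j.2
    simp only [Fin.lt_def, Fin.ext_iff] at h ⊢
    split_ifs at h <;> simp only at h <;> omega

end PBM

namespace PBM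

/-! Two facts are combined, one about gaps and one about information.

Gaps. Each κ_l is the sum of the positive drops κ_j - κ_{j+1} over j ≥ l, with κ_{L+1} = 0, so a
mean reward is a positive combination of prefix sums of the arm means (`sum_exam_mul`). Comparing
prefix sums one by one shows that the gap of an action dominates the sum of Δ_{v_{k,l}} over all
pairs (k,l) such that it shows the arm k > L at position l (`sum_gap_insertArm_le_gap`). With
N_{k,l} the expected number of such rounds, the regret is at least ∑_k ∑_l Δ_{v_{k,l}} N_{k,l}.

Information. Fix k > L and raise θ_k to some x > θ_L. An efficient algorithm plays k rarely under θ,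
yet leaves it out rarely under the new parameter. The Donsker–Varadhan inequality
(`expect_sub_log_le_sum_kl`) turns this discrepancy into ∑_l d(κ_l θ_k, κ_l x) N_{k,l} ≥ c log T for
large T and any c < 1 (`eventually_mul_log_le_sum_kl_mul`); then x decreases to θ_L
(`eventually_mul_log_le`).

The constraints for different k involve disjoint sets of counts, so bounding Δ_{v_{k,l}} below by
the minimal ratio times d(κ_l θ_k, κ_l θ_L) handles each k separately. -/

variable {K L : ℕ}

/-! ### Products of Bernoulli laws -/

/-- The mass function of the Bernoulli law with parameter `p`, for an arbitrary real `p`. -/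
def bernMass (p : ℝ) (b : Bool) : ℝ := if b then p else 1 - p

/-- The mass function of a vector of independent Bernoulli variables with parameters `p`. -/
def prodMass {n : ℕ} (p : Fin n → ℝ) (z : Fin n → Bool) : ℝ := ∏ i, bernMass (p i) (z i)

/-- The click probabilities `κ_l θ_{a_l}` of the positions when action `a` is played. -/
def clickProb (κ : Exam L) (θ : Param K) (a : Action K L) (l : Fin L) : ℝ :=
  (κ l : ℝ) * (θ (a l) : ℝ)

lemma clickProb_mem (κ : Exam L) (θ : Param K) (a : Action K L) (l : Fin L) :
    clickProb κ θ a l ∈ Set.Ioo (0 : ℝ) 1 := by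
  obtain ⟨h1, h2⟩ := (κ l).2
  obtain ⟨h3, h4⟩ := (θ (a l)).2
  refine ⟨mul_pos h1 h3, ?_⟩
  unfold clickProb
  nlinarith

lemma bernMass_pos {p : ℝ} (hp : p ∈ Set.Ioo (0 : ℝ) 1) (b : Bool) : 0 < bernMass p b := by
  obtain ⟨h1, h2⟩ := hp
  cases b <;> simp [bernMass] <;> linarith

lemma sum_bernMass (p : ℝ) : ∑ b, bernMass p b = 1 := by simp [bernMass]

lemma sum_prodMass_mul_prod {n : ℕ} (p : Fin n → ℝ) (g : Fin n → Bool → ℝ) :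
    ∑ z, prodMass p z * ∏ i, g i (z i) = ∏ i, ∑ b, bernMass (p i) b * g i b := by
  simp_rw [prodMass, ← Finset.prod_mul_distrib]
  exact (Fintype.prod_sum fun i b => bernMass (p i) b * g i b).symm

lemma sum_prodMass {n : ℕ} (p : Fin n → ℝ) : ∑ z, prodMass p z = 1 := by
  simpa only [mul_one, Finset.prod_const_one, sum_bernMass] using
    sum_prodMass_mul_prod p fun _ _ => 1

lemma sum_prodMass_mul_apply {n : ℕ} (p : Fin n → ℝ) (i : Fin n) (g : Bool → ℝ) :
    ∑ z, prodMass p z * g (z i) = ∑ b, bernMass (p i) b * g b := by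
  have h := sum_prodMass_mul_prod p fun j b => if j = i then g b else 1
  rw [Finset.prod_eq_single i] at h
  · simpa using h
  · intro j _ hj
    simpa [hj] using sum_bernMass (p j)
  · simp

/-- The expectation of a sum of functions of the coordinates. -/
lemma sum_prodMass_mul_sum {n : ℕ} (p : Fin n → ℝ) (g : Fin n → Bool → ℝ) :
    ∑ z, prodMass p z * ∑ i, g i (z i) = ∑ i, ∑ b, bernMass (p i) b * g i b := by
  simp_rw [Finset.mul_sum]
  rw [Finset.sum_comm]
  exact Finset.sum_congr rfl fun i _ => sum_prodMass_mul_apply p i (g i)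

lemma bern_apply_toReal (p : Set.Icc (0 : ℝ) 1) (b : Bool) :
    (bern p b).toReal = bernMass p b := by
  have h1 := p.2.1
  have h2 := p.2.2
  rw [bern, PMF.ofFintype_apply, ENNReal.toReal_ofReal]
  · rfl
  · cases b <;> simp <;> linarith

lemma indep_apply_toReal {n : ℕ} (p : Fin n → Set.Icc (0 : ℝ) 1) (z : Fin n → Bool) :
    (indep (fun i => bern (p i)) z).toReal = prodMass (fun i => (p i : ℝ)) z := by
  simp [indep, PMF.ofFintype_apply, ENNReal.toReal_prod, bern_apply_toReal, prodMass]

lemma toReal_sum_mul {α : Type*} [Fintype α] (f g : α → ℝ≥0∞) (hf : ∀ a, f a ≠ ∞)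
    (hg : ∀ a, g a ≠ ∞) : (∑ a, f a * g a).toReal = ∑ a, (f a).toReal * (g a).toReal := by
  rw [ENNReal.toReal_sum fun a _ => ENNReal.mul_ne_top (hf a) (hg a)]
  simp_rw [ENNReal.toReal_mul]

lemma bind_apply_toReal {α β : Type*} [Fintype α] (p : PMF α) (f : α → PMF β) (b : β) :
    (p.bind f b).toReal = ∑ a, (p a).toReal * (f a b).toReal := by
  rw [PMF.bind_apply, tsum_fintype,
    toReal_sum_mul _ _ (fun a => p.apply_ne_top a) fun a => (f a).apply_ne_top b]

lemma map_apply_toReal {α β : Type*} [Fintype α] [DecidableEq β] (p : PMF α) (f : α → β) (b : β) :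
    (p.map f b).toReal = ∑ a, (p a).toReal * if b = f a then 1 else 0 := by
  rw [← PMF.bind_pure_comp, bind_apply_toReal]
  refine Finset.sum_congr rfl fun a _ => ?_
  simp only [Function.comp, PMF.pure_apply]
  split_ifs <;> simp_all

/-- Under action `a` the observations are independent Bernoulli variables with parameters
`κ_l θ_{a_l}`. -/
lemma feedback_apply_toReal (κ : Exam L) (θ : Param K) (a : Action K L) (z : Obs L) :
    (feedback κ θ a z).toReal = prodMass (clickProb κ θ a) z := by
  classical
  rw [feedback, bind_apply_toReal]
  simp_rw [map_apply_toReal, indep_apply_toReal]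
  -- The indicator of the event Z = z factors over positions, so both sums factor and only a
  -- one-position identity remains.
  have hind : ∀ x y : Obs L, (if z = fun l => x l && y l then (1 : ℝ) else 0)
      = ∏ l, if z l = (x l && y l) then 1 else 0 := by
    intro x y
    rw [Finset.prod_boole]
    simp [funext_iff]
  simp_rw [hind]
  have h2 : ∀ y : Obs L, ∑ x, prodMass (fun l => (θ (a l) : ℝ)) x *
      (∏ l, if z l = (x l && y l) then (1 : ℝ) else 0)
      = ∏ l, ∑ b, bernMass (θ (a l)) b * if z l = (b && y l) then 1 else 0 := fun y =>
    sum_prodMass_mul_prod _ fun l b => if z l = (b && y l) then 1 else 0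
  simp_rw [h2]
  rw [sum_prodMass_mul_prod (fun l => (κ l : ℝ)) fun l c =>
    ∑ b, bernMass (θ (a l)) b * if z l = (b && c) then 1 else 0]
  refine Finset.prod_congr rfl fun l _ => ?_
  cases z l <;> simp [bernMass, clickProb]
  ring

/-! ### Expectations over histories and the regret -/

/-- The expectation of a function of the history of the first `T` rounds. -/
noncomputable def expect (κ : Exam L) (θ : Param K) (π : Policy K L) (T : ℕ)
    (f : History K L T → ℝ) : ℝ :=
  ∑ h, (historyLaw κ θ π T h).toReal * f h

/-- Splitting off the last round of a history. -/
def historySnoc (T : ℕ) : History K L T × (Action K L × Obs L) ≃ History K L (T + 1) where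
  toFun x := Fin.snoc x.1 x.2
  invFun h := (Fin.init h, h (Fin.last T))
  left_inv x := by simp
  right_inv h := by simp

lemma historyLaw_snoc_toReal (κ : Exam L) (θ : Param K) (π : Policy K L) (T : ℕ)
    (x : History K L T × (Action K L × Obs L)) :
    (historyLaw κ θ π (T + 1) (historySnoc T x)).toReal =
      (historyLaw κ θ π T x.1).toReal *
        ((π T x.1 x.2.1).toReal * prodMass (clickProb κ θ x.2.1) x.2.2) := by
  classical
  obtain ⟨h, a, z⟩ := x
  rw [historyLaw, bind_apply_toReal]
  simp_rw [bind_apply_toReal, map_apply_toReal, feedback_apply_toReal]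
  -- Appending a round is injective, so a single past, action and observation contribute to the
  -- triple sum.
  have key : ∀ (h' : History K L T) (a' : Action K L) (z' : Obs L),
      (if historySnoc T (h, a, z) = (Fin.snoc h' (a', z') : History K L (T + 1)) then (1 : ℝ) else 0)
      = (if h = h' then 1 else 0) * ((if a = a' then 1 else 0) * (if z = z' then 1 else 0)) := by
    intro h' a' z'
    have : (Fin.snoc h' (a', z') : History K L (T + 1)) = historySnoc T (h', a', z') := rfl
    simp only [this, (historySnoc T).injective.eq_iff, Prod.mk.injEq]
    split_ifs <;> simp_all
  simp_rw [key]
  rw [Finset.sum_eq_single h (by intro b _ hb; simp [hb.symm]) (by simp),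
    Finset.sum_eq_single a (by intro b _ hb; simp [hb.symm]) (by simp),
    Finset.sum_eq_single z (by intro b _ hb; simp [hb.symm]) (by simp)]
  simp

/-- Tower property: the last round is integrated out given the past, which drives inductions on `T`.
-/
lemma expect_succ (κ : Exam L) (θ : Param K) (π : Policy K L) (T : ℕ)
    (f : History K L (T + 1) → ℝ) :
    expect κ θ π (T + 1) f = expect κ θ π T fun h =>
      ∑ a, (π T h a).toReal * ∑ z, prodMass (clickProb κ θ a) z *
        f (historySnoc T (h, a, z)) := by
  rw [expect, ← (historySnoc T).sum_comp, Fintype.sum_prod_type]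
  refine Finset.sum_congr rfl fun h _ => ?_
  rw [Fintype.sum_prod_type, Finset.mul_sum]
  refine Finset.sum_congr rfl fun a _ => ?_
  rw [Finset.mul_sum, Finset.mul_sum]
  refine Finset.sum_congr rfl fun z _ => ?_
  rw [historyLaw_snoc_toReal]
  ring

lemma sum_toReal_eq_one {α : Type*} [Fintype α] (p : PMF α) : ∑ a, (p a).toReal = 1 := by
  rw [← ENNReal.toReal_sum fun a _ => p.apply_ne_top a, ← tsum_fintype (L := .unconditional _),
    p.tsum_coe, ENNReal.toReal_one]

lemma expect_const (κ : Exam L) (θ : Param K) (π : Policy K L) (T : ℕ) (c : ℝ) :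
    expect κ θ π T (fun _ => c) = c := by
  rw [expect, ← Finset.sum_mul, sum_toReal_eq_one, one_mul]

lemma expect_add (κ : Exam L) (θ : Param K) (π : Policy K L) (T : ℕ) (f g : History K L T → ℝ) :
    expect κ θ π T (fun h => f h + g h) = expect κ θ π T f + expect κ θ π T g := by
  simp [expect, mul_add, Finset.sum_add_distrib]

lemma expect_sub (κ : Exam L) (θ : Param K) (π : Policy K L) (T : ℕ) (f g : History K L T → ℝ) :
    expect κ θ π T (fun h => f h - g h) = expect κ θ π T f - expect κ θ π T g := by
  simp [expect, mul_sub, Finset.sum_sub_distrib]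

lemma expect_const_mul (κ : Exam L) (θ : Param K) (π : Policy K L) (T : ℕ) (c : ℝ)
    (f : History K L T → ℝ) :
    expect κ θ π T (fun h => c * f h) = c * expect κ θ π T f := by
  simp only [expect, Finset.mul_sum]
  exact Finset.sum_congr rfl fun h _ => by ring

lemma expect_sum (κ : Exam L) (θ : Param K) (π : Policy K L) (T : ℕ) {ι : Type*} (s : Finset ι)
    (f : ι → History K L T → ℝ) :
    expect κ θ π T (fun h => ∑ i ∈ s, f i h) = ∑ i ∈ s, expect κ θ π T (f i) := by
  simp only [expect, Finset.mul_sum]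
  exact Finset.sum_comm

lemma expect_mono (κ : Exam L) (θ : Param K) (π : Policy K L) (T : ℕ) {f g : History K L T → ℝ}
    (hfg : ∀ h, f h ≤ g h) : expect κ θ π T f ≤ expect κ θ π T g :=
  Finset.sum_le_sum fun h _ => mul_le_mul_of_nonneg_left (hfg h) ENNReal.toReal_nonneg

lemma sum_historySnoc {T : ℕ} (x : History K L T × (Action K L × Obs L))
    (g : Action K L × Obs L → ℝ) :
    ∑ t, g (historySnoc T x t) = ∑ t, g (x.1 t) + g x.2 := by
  rw [Fin.sum_univ_castSucc]
  simp [historySnoc]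

/-- In an expectation, a function of the observations of each round may be replaced by its
conditional expectation given the action. -/
lemma expect_sum_rounds (κ : Exam L) (θ : Param K) (π : Policy K L) (T : ℕ)
    (g : Action K L → Obs L → ℝ) :
    expect κ θ π T (fun h => ∑ t, g (h t).1 (h t).2) =
      expect κ θ π T fun h => ∑ t, ∑ z, prodMass (clickProb κ θ (h t).1) z * g (h t).1 z := by
  induction T with
  | zero => simp
  | succ T ih =>
    rw [expect_succ, expect_succ]
    have h1 : ∀ (G : Action K L × Obs L → ℝ) (h : History K L T), (∑ a, (π T h a).toReal *
        ∑ z, prodMass (clickProb κ θ a) z * ∑ t, G (historySnoc T (h, a, z) t)) =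
        ∑ t, G (h t) + ∑ a, (π T h a).toReal * ∑ z, prodMass (clickProb κ θ a) z * G (a, z) := by
      intro G h
      simp_rw [sum_historySnoc, mul_add, Finset.sum_add_distrib, ← Finset.sum_mul, sum_prodMass,
        one_mul, mul_add, Finset.sum_add_distrib, ← Finset.sum_mul, sum_toReal_eq_one, one_mul]
    have e1 := fun h => h1 (fun w => g w.1 w.2) h
    have e2 := fun h => h1 (fun w => ∑ z, prodMass (clickProb κ θ w.1) z * g w.1 z) h
    simp only at e1 e2
    simp_rw [e1, e2, expect_add, ih, ← Finset.sum_mul, sum_prodMass, one_mul]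

lemma sum_prodMass_mul_reward (p : Fin L → ℝ) : ∑ z, prodMass p z * reward z = ∑ l, p l := by
  simp_rw [reward]
  rw [sum_prodMass_mul_sum p fun _ b => if b then (1 : ℝ) else 0]
  simp [bernMass]

/-- The regret is the expected sum of the gaps of the actions played. -/
lemma expectedRegret_eq_expect_gap (κ : Exam L) (θ : Param K) (π : Policy K L) (T : ℕ) :
    expectedRegret κ θ π T = expect κ θ π T fun h => ∑ t, gap κ θ (h t).1 := by
  have h1 := expect_sum_rounds κ θ π T fun _ z => reward z
  simp_rw [sum_prodMass_mul_reward] at h1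
  have h2 : (fun h : History K L T => ∑ t, gap κ θ (h t).1)
      = fun h => T * bestReward L κ θ - ∑ t, ∑ l, clickProb κ θ (h t).1 l := by
    funext h
    simp [gap, meanReward, clickProb]
  rw [h2, expect_sub, expect_const, ← h1]
  rfl

/-! ### Change of measure -/

/-- The log-likelihood ratio of two vectors of independent Bernoulli variables. -/
noncomputable def logRatio {n : ℕ} (p q : Fin n → ℝ) (z : Fin n → Bool) : ℝ :=
  ∑ i, Real.log (bernMass (p i) (z i) / bernMass (q i) (z i))

lemma prodMass_mul_exp_neg_logRatio {n : ℕ} {p q : Fin n → ℝ} (hp : ∀ i, p i ∈ Set.Ioo (0 : ℝ) 1)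
    (hq : ∀ i, q i ∈ Set.Ioo (0 : ℝ) 1) (z : Fin n → Bool) :
    prodMass p z * Real.exp (-logRatio p q z) = prodMass q z := by
  rw [logRatio, ← Finset.sum_neg_distrib, Real.exp_sum, prodMass, ← Finset.prod_mul_distrib]
  refine Finset.prod_congr rfl fun i _ => ?_
  have h1 := bernMass_pos (hp i) (z i)
  have h2 := bernMass_pos (hq i) (z i)
  rw [Real.exp_neg, Real.exp_log (div_pos h1 h2)]
  field_simp

lemma sum_prodMass_mul_logRatio {n : ℕ} (p q : Fin n → ℝ) :
    ∑ z, prodMass p z * logRatio p q z = ∑ i, kl (p i) (q i) := by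
  simp_rw [logRatio]
  rw [sum_prodMass_mul_sum p fun i b => Real.log (bernMass (p i) b / bernMass (q i) b)]
  simp [bernMass, kl]

/-- The log-likelihood ratio of a history under the parameters `θ` and `lam`. -/
noncomputable def historyLogRatio (κ : Exam L) (θ lam : Param K) {T : ℕ} (h : History K L T) : ℝ :=
  ∑ t, logRatio (clickProb κ θ (h t).1) (clickProb κ lam (h t).1) (h t).2

/-- The change of measure from `θ` to `lam`. -/
lemma historyLaw_change_of_measure (κ : Exam L) (θ lam : Param K) (π : Policy K L) (T : ℕ)
    (h : History K L T) :
    (historyLaw κ θ π T h).toReal * Real.exp (-historyLogRatio κ θ lam h)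
      = (historyLaw κ lam π T h).toReal := by
  induction T with
  | zero => simp [historyLogRatio, historyLaw]
  | succ T ih =>
    obtain ⟨x, rfl⟩ := (historySnoc T).surjective h
    have e : historyLogRatio κ θ lam (historySnoc T x) = historyLogRatio κ θ lam x.1 +
        logRatio (clickProb κ θ x.2.1) (clickProb κ lam x.2.1) x.2.2 :=
      sum_historySnoc x fun w => logRatio (clickProb κ θ w.1) (clickProb κ lam w.1) w.2
    -- The policy factor is the same under both parameters, so only the observation masses enter the
    -- ratio.
    rw [historyLaw_snoc_toReal, historyLaw_snoc_toReal, e, neg_add, Real.exp_add, ← ih x.1,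
      ← prodMass_mul_exp_neg_logRatio (clickProb_mem κ θ x.2.1) (clickProb_mem κ lam x.2.1) x.2.2]
    ring

lemma exp_expect_le (κ : Exam L) (θ : Param K) (π : Policy K L) (T : ℕ) (f : History K L T → ℝ) :
    Real.exp (expect κ θ π T f) ≤ expect κ θ π T fun h => Real.exp (f h) := by
  have := convexOn_exp.map_sum_le (t := Finset.univ)
    (w := fun h => (historyLaw κ θ π T h).toReal) (p := f)
    (fun h _ => ENNReal.toReal_nonneg) (sum_toReal_eq_one _) (fun _ _ => Set.mem_univ _)
  simpa [expect] using this

/-- The Donsker–Varadhan inequality for the laws of the history under two parameters. -/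
lemma expect_sub_log_le_sum_kl (κ : Exam L) (θ lam : Param K) (π : Policy K L) (T : ℕ)
    (φ : History K L T → ℝ) :
    expect κ θ π T φ - Real.log (expect κ lam π T fun h => Real.exp (φ h)) ≤
      expect κ θ π T fun h =>
        ∑ t, ∑ l, kl (clickProb κ θ (h t).1 l) (clickProb κ lam (h t).1 l) := by
  have h1 := expect_sum_rounds κ θ π T fun a z =>
    logRatio (clickProb κ θ a) (clickProb κ lam a) z
  simp_rw [sum_prodMass_mul_logRatio] at h1
  rw [← h1]
  -- Jensen for `φ` minus the log-likelihood ratio; the change of measure makes the right side an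
  -- expectation under `lam`.
  have h2 := exp_expect_le κ θ π T fun h => φ h - historyLogRatio κ θ lam h
  have h3 : (expect κ θ π T fun h => Real.exp (φ h - historyLogRatio κ θ lam h))
      = expect κ lam π T fun h => Real.exp (φ h) := by
    refine Finset.sum_congr rfl fun h _ => ?_
    rw [← historyLaw_change_of_measure κ θ lam π T h]
    simp only [sub_eq_add_neg, Real.exp_add]
    ring
  rw [h3, expect_sub] at h2
  have h4 := (Real.le_log_iff_exp_le (lt_of_lt_of_le (Real.exp_pos _) h2)).2 h2
  have h5 : expect κ θ π T (fun h => historyLogRatio κ θ lam h) = expect κ θ π T fun h =>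
      ∑ t, logRatio (clickProb κ θ (h t).1) (clickProb κ lam (h t).1) (h t).2 := rfl
  linarith

/-! ### Gaps through prefix sums -/

/-- The examination probabilities, extended by `0`. -/
def examExt (κ : Exam L) (n : ℕ) : ℝ := if h : n < L then (κ ⟨n, h⟩ : ℝ) else 0

/-- The decrease of the examination probability after a position. -/
def examDrop (κ : Exam L) (n : ℕ) : ℝ := examExt κ n - examExt κ (n + 1)

/-- At the last position the drop is κ_L itself, thanks to the extension by `0`. -/
lemma examDrop_pos {κ : Exam L} (hκ : StrictAnti κ) (j : Fin L) : 0 < examDrop κ j := by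
  rw [examDrop, examExt, examExt, dif_pos j.2]
  split_ifs with h
  · have : κ ⟨j + 1, h⟩ < κ j := hκ (by simp [Fin.lt_def])
    have h' : (κ ⟨j + 1, h⟩ : ℝ) < κ j := this
    simpa using h'
  · simpa using (κ j).2.1

lemma sum_range_ite_sub (f : ℕ → ℝ) (l n : ℕ) :
    (∑ j ∈ Finset.range n, if l ≤ j then f j - f (j + 1) else 0)
      = if l ≤ n then f l - f n else 0 := by
  induction n with
  | zero =>
    rcases Nat.eq_zero_or_pos l with rfl | h
    · simp
    · simp [h.ne']
  | succ n ih =>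
    rw [Finset.sum_range_succ, ih]
    rcases lt_trichotomy l (n + 1) with h | h | h
    · simp [Nat.lt_succ_iff.1 h, h.le]
    · simp [h]
    · simp [show ¬ l ≤ n by omega, show ¬ l ≤ n + 1 by omega]

lemma exam_eq_sum_examDrop (κ : Exam L) (l : Fin L) :
    (κ l : ℝ) = ∑ j : Fin L, if l ≤ j then examDrop κ j else 0 := by
  have := sum_range_ite_sub (examExt κ) l L
  rw [← Fin.sum_univ_eq_sum_range (fun j => if (l : ℕ) ≤ j then
    examExt κ j - examExt κ (j + 1) else 0)] at this
  rw [if_pos l.2.le] at this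
  simp only [Fin.le_def, examDrop]
  rw [this]
  simp [examExt]

/-- Abel summation: with positive drops, comparing weighted sums reduces to comparing all prefix
sums. -/
lemma sum_exam_mul (κ : Exam L) (f : Fin L → ℝ) :
    ∑ l, (κ l : ℝ) * f l = ∑ j : Fin L, examDrop κ j * ∑ i, if i ≤ j then f i else 0 := by
  simp_rw [Finset.mul_sum]
  rw [Finset.sum_comm]
  refine Finset.sum_congr rfl fun l _ => ?_
  rw [exam_eq_sum_examDrop, Finset.sum_mul]
  refine Finset.sum_congr rfl fun j _ => ?_
  split_ifs <;> simp

/-- Once the prefix reaches the insertion point, the inserted `x` enters and the shift pushes out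
exactly the last term `s n`. -/
lemma sum_range_insert (s : ℕ → ℝ) (x : ℝ) (l n : ℕ) :
    (∑ i ∈ Finset.range (n + 1), if i < l then s i else if i = l then x else s (i - 1))
      = ∑ i ∈ Finset.range (n + 1), s i + if l ≤ n then x - s n else 0 := by
  induction n with
  | zero => rcases Nat.eq_zero_or_pos l with rfl | h
            · simp
            · simp [h, h.ne']
  | succ n ih =>
    rw [Finset.sum_range_succ, ih, Finset.sum_range_succ _ (n + 1)]
    rcases lt_trichotomy l (n + 1) with h | h | h
    · simp [Nat.lt_succ_iff.1 h, h.le, h.ne', not_lt.2 h.le]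
      ring
    · simp [h]
    · simp [show ¬ l ≤ n by omega, show ¬ l ≤ n + 1 by omega, h]

lemma sum_ite_le_eq_sum_range (f : ℕ → ℝ) (j : Fin L) :
    (∑ i : Fin L, if i ≤ j then f i else 0) = ∑ i ∈ Finset.range (j + 1), f i := by
  simp only [Fin.le_def]
  rw [Fin.sum_univ_eq_sum_range (fun i => if i ≤ (j : ℕ) then f i else 0), ← Finset.sum_filter]
  refine Finset.sum_congr ?_ fun _ _ => rfl
  ext i
  have := j.2
  simp only [Finset.mem_filter, Finset.mem_range]
  omega

lemma sum_ite_le_insertArm (hLK : L ≤ K) (θ : Param K) (k : {k : Fin K // L ≤ (k : ℕ)})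
    (l j : Fin L) :
    (∑ i : Fin L, if i ≤ j then (θ (insertArm k l i) : ℝ) else 0)
      = (∑ i : Fin L, if i ≤ j then (θ (i.castLE hLK) : ℝ) else 0)
        + if l ≤ j then (θ k.1 : ℝ) - θ (j.castLE hLK) else 0 := by
  set s : ℕ → ℝ := fun n => if h : n < L then θ ⟨n, by omega⟩ else 0
  have hs : ∀ i : Fin L, (θ (i.castLE hLK) : ℝ) = s i := fun i => by
    simp only [s, dif_pos i.2]; rfl
  have hv : ∀ i : Fin L, (θ (insertArm k l i) : ℝ)
      = if (i : ℕ) < l then s i else if (i : ℕ) = l then (θ k.1 : ℝ) else s (i - 1) := by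
    intro i
    have h1 := i.2
    simp only [insertArm, Function.Embedding.coeFn_mk, Fin.lt_def, Fin.ext_iff]
    split_ifs
    · simp only [s, dif_pos i.2]
    · rfl
    · simp only [s, dif_pos (show (i : ℕ) - 1 < L by omega)]
  simp_rw [hs, hv]
  rw [sum_ite_le_eq_sum_range (fun i => if i < (l : ℕ) then s i else if i = (l : ℕ) then
    (θ k.1 : ℝ) else s (i - 1)), sum_ite_le_eq_sum_range, sum_range_insert]
  rfl

/-- Positive parts above the threshold θ_j vanish for arms after `j`, and `a` is injective, so no
list collects more than the arms up to `j` do. -/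
lemma sum_pos_part_comp_le {θ : Param K} (hθ : Antitone θ) (hLK : L ≤ K) (a : Action K L)
    (j : Fin L) (s : Finset (Fin L)) :
    ∑ i ∈ s, max ((θ (a i) : ℝ) - θ (j.castLE hLK)) 0 ≤
      ∑ i : Fin L, if i ≤ j then (θ (i.castLE hLK) : ℝ) - θ (j.castLE hLK) else 0 := by
  set g : Fin K → ℝ := fun m => max ((θ m : ℝ) - θ (j.castLE hLK)) 0
  have h0 : ∀ m, 0 ≤ g m := fun m => le_max_right _ _
  have hg : ∀ m : Fin K, j.castLE hLK < m → g m = 0 := fun m hm =>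
    max_eq_right (sub_nonpos.2 (hθ hm.le))
  calc ∑ i ∈ s, g (a i) = ∑ m ∈ s.map a, g m := by rw [Finset.sum_map]
    _ ≤ ∑ m, g m := Finset.sum_le_sum_of_subset_of_nonneg (Finset.subset_univ _) fun m _ _ => h0 m
    _ = ∑ m ∈ Finset.univ.map (Fin.castLEEmb hLK), g m := by
        refine (Finset.sum_subset (Finset.subset_univ _) fun m _ hm => hg m ?_).symm
        by_contra hcon
        refine hm (Finset.mem_map.2 ⟨⟨m, ?_⟩, Finset.mem_univ _, ?_⟩)
        · have := j.2
          simp only [Fin.lt_def, Fin.val_castLE] at hcon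
          omega
        · rfl
    _ = ∑ i : Fin L, g (i.castLE hLK) := by rw [Finset.sum_map]; rfl
    _ = _ := by
        refine Finset.sum_congr rfl fun i _ => ?_
        split_ifs with h
        · exact max_eq_left (sub_nonneg.2 (hθ (show i.castLE hLK ≤ j.castLE hLK from h)))
        · exact hg _ (show j.castLE hLK < i.castLE hLK from not_le.1 h)

/-- The prefix-sum form of the gap decomposition. Subtracting the threshold θ_j, each term reduces
to a comparison with max(θ_{a_i} - θ_j, 0): an outside arm contributes 0, any other arm its excess
over θ_j. -/
lemma sum_ite_outside_le {θ : Param K} (hθ : Antitone θ) (hLK : L ≤ K) (a : Action K L)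
    (j : Fin L) :
    (∑ i : Fin L, if i ≤ j then (if L ≤ (a i : ℕ) then (θ (j.castLE hLK) : ℝ) - θ (a i) else 0)
        else 0) ≤
      ∑ i : Fin L, if i ≤ j then (θ (i.castLE hLK) : ℝ) - θ (a i) else 0 := by
  have h1 := sum_pos_part_comp_le hθ hLK a j (Finset.univ.filter fun i => i ≤ j)
  rw [Finset.sum_filter] at h1
  have h2 : (∑ i : Fin L, if i ≤ j then (θ (i.castLE hLK) : ℝ) - θ (a i) else 0)
      = (∑ i : Fin L, if i ≤ j then (θ (i.castLE hLK) : ℝ) - θ (j.castLE hLK) else 0)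
        - ∑ i : Fin L, if i ≤ j then (θ (a i) : ℝ) - θ (j.castLE hLK) else 0 := by
    rw [← Finset.sum_sub_distrib]
    refine Finset.sum_congr rfl fun i _ => ?_
    split_ifs <;> ring
  rw [h2]
  refine le_sub_iff_add_le.2 (le_trans ?_ h1)
  rw [← Finset.sum_add_distrib]
  refine Finset.sum_le_sum fun i _ => ?_
  split_ifs
  · refine le_trans (le_of_eq ?_) (le_max_right _ _)
    ring
  · rw [zero_add]
    exact le_max_left _ _
  · simp

/-- The action that plays the first `L` arms in order. -/
def topAction (hLK : L ≤ K) : Action K L := Fin.castLEEmb hLK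

lemma meanReward_top_sub (hLK : L ≤ K) (κ : Exam L) (θ : Param K) (a : Action K L) :
    meanReward κ θ (topAction hLK) - meanReward κ θ a = ∑ j : Fin L, examDrop κ j *
      ∑ i : Fin L, if i ≤ j then (θ (i.castLE hLK) : ℝ) - θ (a i) else 0 := by
  rw [← sum_exam_mul, meanReward, meanReward, ← Finset.sum_sub_distrib]
  exact Finset.sum_congr rfl fun i _ => (mul_sub _ _ _).symm

lemma sum_ite_outside_nonneg {θ : Param K} (hθ : Antitone θ) (hLK : L ≤ K) (a : Action K L)
    (j : Fin L) :
    0 ≤ ∑ i : Fin L, if i ≤ j then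
      (if L ≤ (a i : ℕ) then (θ (j.castLE hLK) : ℝ) - θ (a i) else 0) else 0 := by
  refine Finset.sum_nonneg fun i _ => ?_
  split_ifs with h1 h2
  · refine sub_nonneg.2 (hθ ?_)
    have := j.2
    simp only [Fin.le_def, Fin.val_castLE]
    omega
  all_goals exact le_rfl

lemma bestReward_eq (hLK : L ≤ K) {κ : Exam L} (hκ : StrictAnti κ) {θ : Param K}
    (hθ : Antitone θ) : bestReward L κ θ = meanReward κ θ (topAction hLK) := by
  have : Nonempty (Action K L) := ⟨topAction hLK⟩
  refine le_antisymm (ciSup_le fun a => ?_) (le_ciSup (Set.finite_range _).bddAbove _)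
  rw [← sub_nonneg, meanReward_top_sub]
  exact Finset.sum_nonneg fun j _ => mul_nonneg (examDrop_pos hκ j).le
    ((sum_ite_outside_nonneg hθ hLK a j).trans (sum_ite_outside_le hθ hLK a j))

lemma meanReward_le_bestReward (κ : Exam L) (θ : Param K) (a : Action K L) :
    meanReward κ θ a ≤ bestReward L κ θ :=
  le_ciSup (f := fun a => meanReward κ θ a) (Set.finite_range _).bddAbove a

lemma gap_nonneg (κ : Exam L) (θ : Param K) (a : Action K L) : 0 ≤ gap κ θ a :=
  sub_nonneg.2 (meanReward_le_bestReward κ θ a)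

/-- Inserting `k` at `l` replaces θ_j by θ_k in each prefix sum ending at some j ≥ l and leaves the
shorter ones unchanged. -/
lemma gap_insertArm (hLK : L ≤ K) {κ : Exam L} (hκ : StrictAnti κ) {θ : Param K}
    (hθ : Antitone θ) (k : {k : Fin K // L ≤ (k : ℕ)}) (l : Fin L) :
    gap κ θ (insertArm k l) = ∑ j : Fin L, examDrop κ j *
      if l ≤ j then (θ (j.castLE hLK) : ℝ) - θ k.1 else 0 := by
  rw [gap, bestReward_eq hLK hκ hθ, meanReward_top_sub]
  refine Finset.sum_congr rfl fun j _ => ?_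
  congr 1
  have h1 := sum_ite_le_insertArm hLK θ k l j
  have h2 : (∑ i : Fin L, if i ≤ j then (θ (i.castLE hLK) : ℝ) - θ (insertArm k l i) else 0)
      = (∑ i : Fin L, if i ≤ j then (θ (i.castLE hLK) : ℝ) else 0)
        - ∑ i : Fin L, if i ≤ j then (θ (insertArm k l i) : ℝ) else 0 := by
    rw [← Finset.sum_sub_distrib]
    refine Finset.sum_congr rfl fun i _ => ?_
    split_ifs <;> ring
  rw [h2, h1]
  split_ifs <;> ring

lemma gap_insertArm_pos (hLK : L ≤ K) {κ : Exam L} (hκ : StrictAnti κ) {θ : Param K}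
    (hθ : StrictAnti θ) (k : {k : Fin K // L ≤ (k : ℕ)}) (l : Fin L) :
    0 < gap κ θ (insertArm k l) := by
  have hlt : ∀ j : Fin L, (θ k.1 : ℝ) < θ (j.castLE hLK) := fun j =>
    hθ (by have := j.2; have := k.2; simp only [Fin.lt_def, Fin.val_castLE]; omega)
  rw [gap_insertArm hLK hκ hθ.antitone]
  refine Finset.sum_pos' (fun j _ => mul_nonneg (examDrop_pos hκ j).le ?_)
    ⟨l, Finset.mem_univ _, mul_pos (examDrop_pos hκ l) ?_⟩
  · split_ifs
    · exact (sub_pos.2 (hlt j)).le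
    · exact le_rfl
  · simpa using hlt l

/-- The gap of an action is at least the sum of the gaps of the lists in which only one of its
arms outside the first `L` ones is inserted, at the same position. -/
lemma sum_gap_insertArm_le_gap (hLK : L ≤ K) {κ : Exam L} (hκ : StrictAnti κ) {θ : Param K}
    (hθ : Antitone θ) (a : Action K L) :
    (∑ k : {k : Fin K // L ≤ (k : ℕ)}, ∑ l, if a l = k then gap κ θ (insertArm k l) else 0)
      ≤ gap κ θ a := by
  have h1 : ∀ l : Fin L, (∑ k : {k : Fin K // L ≤ (k : ℕ)},
      if a l = k then gap κ θ (insertArm k l) else 0) = ∑ j : Fin L, examDrop κ j *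
        if l ≤ j then (if L ≤ (a l : ℕ) then (θ (j.castLE hLK) : ℝ) - θ (a l) else 0) else 0 := by
    intro l
    by_cases h : L ≤ (a l : ℕ)
    · rw [Finset.sum_eq_single ⟨a l, h⟩]
      · simp [gap_insertArm hLK hκ hθ, h]
      · rintro ⟨k, hk⟩ _ hne
        rw [if_neg]
        rintro rfl
        exact hne rfl
      · simp
    · rw [Finset.sum_eq_zero, Finset.sum_eq_zero]
      · simp [h]
      · rintro ⟨k, hk⟩ _
        rw [if_neg]
        rintro rfl
        exact h hk
  rw [Finset.sum_comm]
  simp_rw [h1]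
  rw [Finset.sum_comm, gap, bestReward_eq hLK hκ hθ, meanReward_top_sub]
  refine Finset.sum_le_sum fun j _ => ?_
  rw [← Finset.mul_sum]
  exact mul_le_mul_of_nonneg_left (sum_ite_outside_le hθ hLK a j) (examDrop_pos hκ j).le

/-! ### Binary Kullback–Leibler divergence -/

lemma kl_self {p : ℝ} (hp : p ∈ Set.Ioo (0 : ℝ) 1) : kl p p = 0 := by
  have h1 : p ≠ 0 := hp.1.ne'
  have h2 : 1 - p ≠ 0 := (sub_pos.2 hp.2).ne'
  simp [kl, h1, h2]

/-- This is log u < u - 1 at u = q/p. Adding the instances for (p, q) and (1-p, 1-q) cancels the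
linear terms and gives positivity of `kl`. -/
lemma sub_lt_mul_log_div {p q : ℝ} (hp : 0 < p) (hq : 0 < q) (hpq : p ≠ q) :
    p - q < p * Real.log (p / q) := by
  have h := Real.log_lt_sub_one_of_pos (div_pos hq hp)
    (fun h => hpq ((div_eq_one_iff_eq hp.ne').1 h).symm)
  rw [← inv_div, Real.log_inv]
  have h2 := mul_lt_mul_of_pos_left h hp
  have h3 : p * (q / p - 1) = q - p := by field_simp
  linarith

lemma kl_pos {p q : ℝ} (hp : p ∈ Set.Ioo (0 : ℝ) 1) (hq : q ∈ Set.Ioo (0 : ℝ) 1) (hpq : p ≠ q) :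
    0 < kl p q := by
  have h1 := sub_lt_mul_log_div hp.1 hq.1 hpq
  have h2 := sub_lt_mul_log_div (sub_pos.2 hp.2) (sub_pos.2 hq.2)
    (fun h => hpq (sub_right_injective h))
  unfold kl
  linarith

lemma continuousAt_kl_right {p q : ℝ} (hp : p ∈ Set.Ioo (0 : ℝ) 1) (hq : q ∈ Set.Ioo (0 : ℝ) 1) :
    ContinuousAt (kl p) q := by
  have h1 : q ≠ 0 := hq.1.ne'
  have h2 : 1 - q ≠ 0 := (sub_pos.2 hq.2).ne'
  have h3 : p / q ≠ 0 := (div_pos hp.1 hq.1).ne'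
  have h4 : (1 - p) / (1 - q) ≠ 0 := (div_pos (sub_pos.2 hp.2) (sub_pos.2 hq.2)).ne'
  unfold kl
  exact (continuousAt_const.mul ((continuousAt_const.div continuousAt_id h1).log h3)).add
    (continuousAt_const.mul
      ((continuousAt_const.div (continuousAt_const.sub continuousAt_id) h2).log h4))

/-! ### Play counts and consequences of efficiency -/

/-- The indicator that action `a` plays arm `k`. -/
def plays (k : Fin K) (a : Action K L) : ℝ := ∑ l, if a l = k then 1 else 0

lemma plays_apply (a : Action K L) (l : Fin L) : plays (a l) a = 1 := by
  simp [plays, a.injective.eq_iff]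

lemma plays_eq_zero {k : Fin K} {a : Action K L} (h : ∀ l, a l ≠ k) : plays k a = 0 := by
  simp [plays, h]

lemma plays_mem (k : Fin K) (a : Action K L) : plays k a ∈ Set.Icc (0 : ℝ) 1 := by
  by_cases h : ∃ l, a l = k
  · obtain ⟨l, rfl⟩ := h
    simp [plays_apply]
  · rw [plays_eq_zero (not_exists.1 h)]
    simp

/-- The expected number of rounds in which arm `k` is played at position `l`. -/
noncomputable def expectedCount (κ : Exam L) (θ : Param K) (π : Policy K L) (T : ℕ) (k : Fin K)
    (l : Fin L) : ℝ :=
  expect κ θ π T fun h => ∑ t, if (h t).1 l = k then 1 else 0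

lemma expect_sum_plays_weighted (κ : Exam L) (θ : Param K) (π : Policy K L) (T : ℕ) (k : Fin K)
    (d : Fin L → ℝ) :
    (expect κ θ π T fun h => ∑ t, ∑ l, if (h t).1 l = k then d l else 0)
      = ∑ l, d l * expectedCount κ θ π T k l := by
  simp_rw [expectedCount, ← expect_const_mul]
  rw [← expect_sum]
  congr 1
  funext h
  rw [Finset.sum_comm]
  refine Finset.sum_congr rfl fun l _ => ?_
  rw [Finset.mul_sum]
  exact Finset.sum_congr rfl fun t _ => by split_ifs <;> simp

lemma expectedCount_nonneg (κ : Exam L) (θ : Param K) (π : Policy K L) (T : ℕ) (k : Fin K)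
    (l : Fin L) : 0 ≤ expectedCount κ θ π T k l := by
  rw [← expect_const κ θ π T 0]
  refine expect_mono κ θ π T fun h => Finset.sum_nonneg fun t _ => ?_
  split_ifs <;> simp

/-- A uniformly efficient algorithm makes choices that have a positive gap only `o(T^α)` times. -/
lemma UniformlyEfficient.eventually_expect_le {κ : Exam L} {π : Policy K L}
    (hπ : UniformlyEfficient κ π) (θ : Param K) {g : Action K L → ℝ} {δ : ℝ} (hδ : 0 < δ)
    (hg : ∀ a, δ * g a ≤ gap κ θ a) {α c : ℝ} (hα : 0 < α) (hα1 : α ≤ 1) (hc : 0 < c) :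
    ∀ᶠ T : ℕ in atTop, (expect κ θ π T fun h => ∑ t, g (h t).1) ≤ c * (T : ℝ) ^ α := by
  filter_upwards [(hπ θ α hα hα1).def (mul_pos hδ hc)] with T hT
  have h1 : δ * (expect κ θ π T fun h => ∑ t, g (h t).1) ≤ expectedRegret κ θ π T := by
    rw [expectedRegret_eq_expect_gap, ← expect_const_mul]
    refine expect_mono κ θ π T fun h => ?_
    rw [Finset.mul_sum]
    exact Finset.sum_le_sum fun t _ => hg _
  rw [Real.norm_of_nonneg (Real.rpow_nonneg (Nat.cast_nonneg T) α), mul_assoc] at hT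
  exact le_of_mul_le_mul_left (h1.trans ((le_abs_self _).trans hT)) hδ

lemma exists_pos_le {ι : Type*} [Finite ι] (f : ι → ℝ) (hf : ∀ i, 0 < f i) :
    ∃ δ > 0, ∀ i, δ ≤ f i := by
  rcases isEmpty_or_nonempty ι with h | h
  · exact ⟨1, one_pos, fun i => h.elim i⟩
  · obtain ⟨i, hi⟩ := Finite.exists_min f
    exact ⟨f i, hf i, hi⟩

/-- By the gap decomposition, showing `k` at position `l` costs at least the gap of the
corresponding insertion; δ is a lower bound over the finitely many `l`. -/
lemma exists_mul_plays_le_gap (hLK : L ≤ K) {κ : Exam L} (hκ : StrictAnti κ) {θ : Param K}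
    (hθ : StrictAnti θ) (k : {k : Fin K // L ≤ (k : ℕ)}) :
    ∃ δ > 0, ∀ a : Action K L, δ * plays k.1 a ≤ gap κ θ a := by
  obtain ⟨δ, hδ, h⟩ := exists_pos_le (fun l => gap κ θ (insertArm k l))
    (gap_insertArm_pos hLK hκ hθ k)
  refine ⟨δ, hδ, fun a => le_trans ?_ (sum_gap_insertArm_le_gap hLK hκ hθ.antitone a)⟩
  refine le_trans ?_ (Finset.single_le_sum (fun k' _ => Finset.sum_nonneg fun l _ => ?_)
    (Finset.mem_univ k))
  · rw [plays, Finset.mul_sum]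
    refine Finset.sum_le_sum fun l _ => ?_
    split_ifs
    · simpa using h l
    · simp
  · split_ifs
    · exact gap_nonneg _ _ _
    · exact le_rfl

lemma insertArm_self (k : {k : Fin K // L ≤ (k : ℕ)}) (l : Fin L) : insertArm k l l = k.1 :=
  (if_neg (lt_irrefl l)).trans (if_pos rfl)

lemma insertArm_of_lt (hLK : L ≤ K) (k : {k : Fin K // L ≤ (k : ℕ)}) {l j : Fin L} (h : j < l) :
    insertArm k l j = topAction hLK j :=
  if_pos h

/-- An action without `k` earns the same under both parameters, hence at most the reward of the top
list under θ. Putting `k` in place of the last arm of that list gains κ_L (x - θ_L). -/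
lemma exists_mul_one_sub_plays_le_gap (hLK : L ≤ K) {e : Fin L} (he : (e : ℕ) + 1 = L) {κ : Exam L}
    (hκ : StrictAnti κ) {θ : Param K} (hθ : StrictAnti θ) (k : {k : Fin K // L ≤ (k : ℕ)})
    {x : Set.Ioo (0 : ℝ) 1} (hx : θ (e.castLE hLK) < x) :
    ∃ δ > 0, ∀ a : Action K L, δ * (1 - plays k.1 a) ≤ gap κ (Function.update θ k.1 x) a := by
  have hx' : (θ (e.castLE hLK) : ℝ) < x := hx
  refine ⟨κ e * (x - θ (e.castLE hLK)), mul_pos (κ e).2.1 (sub_pos.2 hx'), fun a => ?_⟩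
  by_cases h : ∃ l, a l = k
  · obtain ⟨l, hl⟩ := h
    rw [← hl, plays_apply, sub_self, mul_zero]
    exact gap_nonneg _ _ _
  · push Not at h
    rw [plays_eq_zero h, sub_zero, mul_one]
    have h1 : meanReward κ (Function.update θ k.1 x) a = meanReward κ θ a := by
      simp [meanReward, Function.update_of_ne (h _)]
    have h2 : meanReward κ θ a ≤ meanReward κ θ (topAction hLK) := by
      rw [← bestReward_eq hLK hκ hθ.antitone]
      exact meanReward_le_bestReward κ θ a
    have h3 := meanReward_le_bestReward κ (Function.update θ k.1 x) (insertArm k e)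
    have h4 : meanReward κ (Function.update θ k.1 x) (insertArm k e)
        - meanReward κ θ (topAction hLK) = κ e * (x - θ (e.castLE hLK)) := by
      rw [meanReward, meanReward, ← Finset.sum_sub_distrib, Finset.sum_eq_single e]
      · rw [insertArm_self, Function.update_self, mul_sub]
        rfl
      · intro j _ hj
        have hje : j < e := by
          have h1 := j.2
          have h2 : (j : ℕ) ≠ e := fun h => hj (Fin.ext h)
          simp only [Fin.lt_def]
          omega
        have h6 : topAction hLK j ≠ k.1 := by
          intro h
          have h1 := j.2
          have h2 := k.2
          have h3 : (j : ℕ) = k.1 := congrArg Fin.val h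
          omega
        rw [insertArm_of_lt hLK k hje, Function.update_of_ne h6, sub_self]
      · simp
    rw [gap, h1]
    linarith

/-- Changing θ_k alone leaves the click probabilities of the other arms unchanged, so only the
position showing `k` is informative. -/
lemma sum_kl_update (κ : Exam L) (θ : Param K) (k : Fin K) (x : Set.Ioo (0 : ℝ) 1)
    (a : Action K L) :
    ∑ l, kl (clickProb κ θ a l) (clickProb κ (Function.update θ k x) a l)
      = ∑ l, if a l = k then kl ((κ l : ℝ) * (θ k : ℝ)) ((κ l : ℝ) * (x : ℝ)) else 0 := by
  refine Finset.sum_congr rfl fun l _ => ?_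
  split_ifs with h
  · simp [clickProb, h]
  · have : clickProb κ (Function.update θ k x) a l = clickProb κ θ a l := by
      simp [clickProb, Function.update_of_ne h]
    rw [this, kl_self (clickProb_mem κ θ a l)]

/-! ### Logarithmic information bound for one arm -/

lemma exp_mul_le_one_add {s y : ℝ} (hs : 0 ≤ s) (hs1 : s ≤ 1) :
    Real.exp (s * y) ≤ 1 + s * Real.exp y := by
  have := convexOn_exp.2 (Set.mem_univ 0) (Set.mem_univ y) (sub_nonneg.2 hs1) hs
    (sub_add_cancel 1 s)
  simp only [smul_eq_mul, mul_zero, zero_add, Real.exp_zero, mul_one] at this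
  linarith

/-- If arm `k` were slightly better than the arms played by the best action, a uniformly efficient
algorithm would play it in most of the rounds: it has to gather the information that excludes
this. -/
lemma eventually_mul_log_le_sum_kl_mul (hLK : L ≤ K) {e : Fin L} (he : (e : ℕ) + 1 = L) {κ : Exam L}
    (hκ : StrictAnti κ) {θ : Param K} (hθ : StrictAnti θ) {π : Policy K L}
    (hπ : UniformlyEfficient κ π) (k : {k : Fin K // L ≤ (k : ℕ)}) {x : Set.Ioo (0 : ℝ) 1}
    (hx : θ (e.castLE hLK) < x) {c : ℝ} (hc0 : 0 < c) (hc1 : c < 1) :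
    ∀ᶠ T : ℕ in atTop, c * Real.log T ≤
      ∑ l, kl ((κ l : ℝ) * (θ k.1 : ℝ)) ((κ l : ℝ) * (x : ℝ)) * expectedCount κ θ π T k.1 l := by
  -- With c = 1 - 3η one has (1 - η)² ≥ 1 - 2η = c + η; the extra η log T absorbs the log 2 below.
  set η : ℝ := (1 - c) / 3 with hη
  have hη0 : 0 < η := by linarith
  have hη1 : η < 1 := by linarith
  set lam : Param K := Function.update θ k.1 x
  obtain ⟨δ, hδ, hg⟩ := exists_mul_plays_le_gap hLK hκ hθ k
  obtain ⟨δ', hδ', hg'⟩ := exists_mul_one_sub_plays_le_gap hLK he hκ hθ k hx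
  have ht : ∀ᶠ T : ℕ in atTop, Real.log 2 / η ≤ Real.log T :=
    (Real.tendsto_log_atTop.comp tendsto_natCast_atTop_atTop).eventually_ge_atTop _
  filter_upwards [hπ.eventually_expect_le θ hδ hg one_pos le_rfl hη0,
    hπ.eventually_expect_le lam hδ' hg' hη0 hη1.le one_pos, ht, eventually_ge_atTop 1]
    with T h1 h2 h3 hT
  have hT1 : (1 : ℝ) ≤ T := by exact_mod_cast hT
  have hT0 : (0 : ℝ) < T := by linarith
  have hlog : 0 ≤ Real.log T := Real.log_nonneg hT1
  -- The Donsker–Varadhan test function is `S * y`, where `S` is the fraction of rounds without `k`.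
  -- The scale gives e^y = T^(1-η), which offsets the bound T^(η-1) on the mean of `S` under `lam`.
  set y : ℝ := (1 - η) * Real.log T with hy
  set S : History K L T → ℝ := fun h => (T : ℝ)⁻¹ * ∑ t, (1 - plays k.1 (h t).1) with hS
  have hS0 : ∀ h, 0 ≤ S h := fun h => mul_nonneg (inv_nonneg.2 hT0.le)
    (Finset.sum_nonneg fun t _ => sub_nonneg.2 (plays_mem k.1 _).2)
  have hS1 : ∀ h, S h ≤ 1 := by
    intro h
    have : ∑ t, (1 - plays k.1 (h t).1) ≤ ∑ t : Fin T, (1 : ℝ) :=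
      Finset.sum_le_sum fun t _ => by linarith [(plays_mem k.1 (h t).1).1]
    simp only [Finset.sum_const, Finset.card_univ, Fintype.card_fin, nsmul_eq_mul, mul_one] at this
    exact (inv_mul_le_one₀ hT0).2 this
  have hmain := expect_sub_log_le_sum_kl κ θ lam π T fun h => S h * y
  simp_rw [lam, sum_kl_update] at hmain
  rw [expect_sum_plays_weighted κ θ π T k.1
    fun l => kl ((κ l : ℝ) * (θ k.1 : ℝ)) ((κ l : ℝ) * (x : ℝ))] at hmain
  refine le_trans ?_ hmain
  -- Efficiency under θ with exponent 1: at most ηT expected plays of `k`.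
  have hθS : 1 - η ≤ expect κ θ π T S := by
    have e : S = fun h => 1 - (T : ℝ)⁻¹ * ∑ t, plays k.1 (h t).1 := by
      funext h
      simp only [hS, Finset.sum_sub_distrib, Finset.sum_const, Finset.card_univ, Fintype.card_fin,
        nsmul_eq_mul, mul_one, mul_sub]
      rw [inv_mul_cancel₀ hT0.ne']
    rw [e, expect_sub, expect_const, expect_const_mul]
    rw [Real.rpow_one] at h1
    have := mul_le_mul_of_nonneg_left h1 (inv_nonneg.2 hT0.le)
    rw [mul_comm η, inv_mul_cancel_left₀ hT0.ne'] at this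
    linarith
  -- Efficiency under `lam` with exponent η, together with the chord bound for the exponential,
  -- gives at most 1 + T^(1-η) T^(η-1) = 2.
  have hlam : (expect κ lam π T fun h => Real.exp (S h * y)) ≤ 2 := by
    have hey : Real.exp y = (T : ℝ) ^ (1 - η) := by
      rw [Real.rpow_def_of_pos hT0, hy, mul_comm]
    have hle : (expect κ lam π T fun h => Real.exp (S h * y))
        ≤ expect κ lam π T fun h => 1 + Real.exp y * S h :=
      expect_mono _ _ _ _ fun h => by
        rw [mul_comm (Real.exp y)]
        exact exp_mul_le_one_add (hS0 h) (hS1 h)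
    rw [expect_add, expect_const, expect_const_mul, hS, expect_const_mul, hey] at hle
    rw [one_mul] at h2
    have h5 := mul_le_mul_of_nonneg_left (mul_le_mul_of_nonneg_left h2 (inv_nonneg.2 hT0.le))
      (Real.rpow_nonneg hT0.le (1 - η))
    have h6 : (T : ℝ) ^ (1 - η) * ((T : ℝ)⁻¹ * (T : ℝ) ^ η) = 1 := by
      rw [← Real.rpow_neg_one, ← Real.rpow_add hT0, ← Real.rpow_add hT0]
      ring_nf
      exact Real.rpow_zero _
    linarith
  have hpos : 0 < expect κ lam π T fun h => Real.exp (S h * y) :=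
    lt_of_lt_of_le (Real.exp_pos _) (exp_expect_le κ lam π T fun h => S h * y)
  have hl2 := Real.log_le_log hpos hlam
  have hφ : (expect κ θ π T fun h => S h * y) = y * expect κ θ π T S := by
    rw [← expect_const_mul]
    simp_rw [mul_comm]
  rw [hφ]
  have h7 : Real.log 2 ≤ η * Real.log T := by
    rw [mul_comm]
    exact (div_le_iff₀ hη0).1 h3
  have hy0 : 0 ≤ y := mul_nonneg (by linarith) hlog
  have h8 := mul_le_mul_of_nonneg_left hθS hy0
  have h9 : (c + η) * Real.log T ≤ y * (1 - η) := by
    rw [hy]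
    have : c + η ≤ (1 - η) * (1 - η) := by nlinarith
    nlinarith
  change _ ≤ y * expect κ θ π T S - Real.log (expect κ lam π T fun h => Real.exp (S h * y))
  linarith

lemma eventually_mul_log_le (hLK : L ≤ K) {e : Fin L} (he : (e : ℕ) + 1 = L) {κ : Exam L}
    (hκ : StrictAnti κ) {θ : Param K} (hθ : StrictAnti θ) {π : Policy K L}
    (hπ : UniformlyEfficient κ π) (k : {k : Fin K // L ≤ (k : ℕ)}) {c : ℝ} (hc0 : 0 < c)
    (hc1 : c < 1) :
    ∀ᶠ T : ℕ in atTop, c * Real.log T ≤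
      ∑ l, kl ((κ l : ℝ) * (θ k.1 : ℝ)) ((κ l : ℝ) * (θ (e.castLE hLK) : ℝ)) *
        expectedCount κ θ π T k.1 l := by
  set m : Fin K := e.castLE hLK with hm
  have hke : (θ k.1 : ℝ) < θ m := hθ (by
    have := k.2
    have := e.2
    simp only [hm, Fin.lt_def, Fin.val_castLE]
    omega)
  have hmem : ∀ (l : Fin L) (y : Set.Ioo (0 : ℝ) 1), (κ l : ℝ) * (y : ℝ) ∈ Set.Ioo (0 : ℝ) 1 :=
    fun l y => ⟨mul_pos (κ l).2.1 y.2.1, by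
      have h1 := (κ l).2
      have h2 := y.2
      nlinarith [h1.1, h1.2, h2.1, h2.2]⟩
  have hd : ∀ l : Fin L, 0 < kl ((κ l : ℝ) * (θ k.1 : ℝ)) ((κ l : ℝ) * (θ m : ℝ)) := fun l =>
    kl_pos (hmem _ _) (hmem _ _) fun h => hke.ne (mul_left_cancel₀ (κ l).2.1.ne' h)
  -- The bound is applied with c' strictly between c and 1; the slack c'/c > 1 pays for moving from
  -- `x` to θ_L by continuity of `kl`.
  set c' : ℝ := (1 + c) / 2 with hc'
  have hcc : 1 < c' / c := (one_lt_div hc0).2 (by linarith)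
  have hnear : ∀ᶠ x in nhdsWithin (θ m : ℝ) (Set.Ioi (θ m : ℝ)), ∀ l : Fin L,
      kl ((κ l : ℝ) * (θ k.1 : ℝ)) ((κ l : ℝ) * x)
        < c' / c * kl ((κ l : ℝ) * (θ k.1 : ℝ)) ((κ l : ℝ) * (θ m : ℝ)) := by
    refine eventually_all.2 fun l => nhdsWithin_le_nhds ?_
    have hcont : ContinuousAt (fun x : ℝ => kl ((κ l : ℝ) * (θ k.1 : ℝ)) ((κ l : ℝ) * x)) (θ m) :=
      ContinuousAt.comp (f := fun x : ℝ => (κ l : ℝ) * x)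
        (continuousAt_kl_right (hmem l _) (hmem l _)) (continuousAt_const.mul continuousAt_id)
    exact hcont.eventually_lt_const (lt_mul_of_one_lt_left (hd l) hcc)
  obtain ⟨x, hxd, hx⟩ := (hnear.and (Ioo_mem_nhdsGT (θ m).2.2)).exists
  have hx' : θ m < (⟨x, (θ m).2.1.trans hx.1, hx.2⟩ : Set.Ioo (0 : ℝ) 1) := hx.1
  filter_upwards [eventually_mul_log_le_sum_kl_mul hLK he hκ hθ hπ k hx'
    (show 0 < c' by linarith) (show c' < 1 by linarith)] with T hT
  have h1 := hT.trans (Finset.sum_le_sum fun l _ =>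
    mul_le_mul_of_nonneg_right (hxd l).le (expectedCount_nonneg κ θ π T k.1 l))
  simp_rw [mul_assoc (c' / c), ← Finset.mul_sum] at h1
  have h2 : c' * Real.log T = c' / c * (c * Real.log T) := by field_simp
  rw [h2] at h1
  exact le_of_mul_le_mul_left h1 (by linarith)

/-! ### Assembly of the regret bound -/

lemma sum_gap_mul_expectedCount_le (hLK : L ≤ K) {κ : Exam L} (hκ : StrictAnti κ) {θ : Param K}
    (hθ : Antitone θ) (π : Policy K L) (T : ℕ) :
    (∑ k : {k : Fin K // L ≤ (k : ℕ)}, ∑ l,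
      gap κ θ (insertArm k l) * expectedCount κ θ π T k.1 l) ≤ expectedRegret κ θ π T := by
  rw [expectedRegret_eq_expect_gap]
  simp_rw [← expect_sum_plays_weighted]
  rw [← expect_sum]
  refine expect_mono κ θ π T fun h => ?_
  rw [Finset.sum_comm]
  exact Finset.sum_le_sum fun t _ => sum_gap_insertArm_le_gap hLK hκ hθ (h t).1

end PBM

theorem theorem3 {K L : ℕ} (hL : 0 < L) (hLK : L ≤ K)
    (κ : PBM.Exam L) (hκ : StrictAnti κ)
    (θ : PBM.Param K) (hθ : StrictAnti θ)
    (π : PBM.Policy K L) (hπ : PBM.UniformlyEfficient κ π) :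
    ((∑ k : {k : Fin K // L ≤ (k : ℕ)}, ⨅ l : Fin L,
        PBM.gap κ θ (PBM.insertArm k l) /
          PBM.kl ((κ l : ℝ) * (θ k.1 : ℝ))
            ((κ l : ℝ) * (θ ⟨L - 1, by omega⟩ : ℝ)) : ℝ) : EReal)
      ≤ Filter.liminf
          (fun T : ℕ => ((PBM.expectedRegret κ θ π T / Real.log (T : ℝ) : ℝ) : EReal))
          Filter.atTop := by
  have : Nonempty (Fin L) := ⟨⟨0, hL⟩⟩
  set d : {k : Fin K // L ≤ (k : ℕ)} → Fin L → ℝ := fun k l =>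
    PBM.kl ((κ l : ℝ) * (θ k.1 : ℝ)) ((κ l : ℝ) * (θ ⟨L - 1, by omega⟩ : ℝ)) with hd
  set m : {k : Fin K // L ≤ (k : ℕ)} → ℝ := fun k =>
    ⨅ l : Fin L, PBM.gap κ θ (PBM.insertArm k l) / d k l with hm
  have hdpos : ∀ k l, 0 < d k l := fun k l => by
    have hke : (θ k.1 : ℝ) < θ ⟨L - 1, by omega⟩ := hθ (by
      have := k.2
      simp only [Fin.lt_def]
      omega)
    have hmem : ∀ y : Set.Ioo (0 : ℝ) 1, (κ l : ℝ) * (y : ℝ) ∈ Set.Ioo (0 : ℝ) 1 := fun y =>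
      ⟨mul_pos (κ l).2.1 y.2.1, by
        have h1 := (κ l).2
        have h2 := y.2
        nlinarith [h1.1, h1.2, h2.1, h2.2]⟩
    exact PBM.kl_pos (hmem _) (hmem _) fun h => hke.ne (mul_left_cancel₀ (κ l).2.1.ne' h)
  have hm0 : ∀ k, 0 ≤ m k := fun k => le_ciInf fun l =>
    div_nonneg (PBM.gap_nonneg κ θ _) (hdpos k l).le
  -- Each gap is traded for a multiple of its divergence, with a factor independent of `l`, so that
  -- the information bound for `k` applies to the whole sum over positions.
  have hml : ∀ k l, m k * d k l ≤ PBM.gap κ θ (PBM.insertArm k l) := fun k l =>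
    (le_div_iff₀ (hdpos k l)).1 (ciInf_le (Set.finite_range _).bddBelow l)
  -- The information bound is available only for factors c < 1; the limit c ↑ 1 is taken at the end.
  have key : ∀ c ∈ Set.Ioo (0 : ℝ) 1, ((c * ∑ k, m k : ℝ) : EReal) ≤ Filter.liminf
      (fun T : ℕ => ((PBM.expectedRegret κ θ π T / Real.log (T : ℝ) : ℝ) : EReal))
      Filter.atTop := by
    rintro c ⟨hc0, hc1⟩
    refine le_liminf_of_le (by isBoundedDefault) ?_
    filter_upwards [eventually_all.2 fun k => PBM.eventually_mul_log_le hLK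
        (e := ⟨L - 1, by omega⟩) (Nat.sub_add_cancel hL) hκ hθ hπ k hc0 hc1,
      eventually_ge_atTop 2] with T hT hT2
    have hlog : 0 < Real.log T := Real.log_pos (by exact_mod_cast hT2)
    rw [EReal.coe_le_coe_iff, le_div_iff₀ hlog]
    refine le_trans ?_ (PBM.sum_gap_mul_expectedCount_le hLK hκ hθ.antitone π T)
    rw [Finset.mul_sum, Finset.sum_mul]
    refine Finset.sum_le_sum fun k _ => ?_
    calc c * m k * Real.log T = m k * (c * Real.log T) := by ring
      _ ≤ m k * ∑ l, d k l * PBM.expectedCount κ θ π T k.1 l :=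
        mul_le_mul_of_nonneg_left (hT k) (hm0 k)
      _ = ∑ l, m k * d k l * PBM.expectedCount κ θ π T k.1 l := by
        rw [Finset.mul_sum]
        exact Finset.sum_congr rfl fun l _ => (mul_assoc _ _ _).symm
      _ ≤ _ := Finset.sum_le_sum fun l _ =>
        mul_le_mul_of_nonneg_right (hml k l) (PBM.expectedCount_nonneg κ θ π T k.1 l)
  have hlim : Tendsto (fun c : ℝ => ((c * ∑ k, m k : ℝ) : EReal)) (nhdsWithin 1 (Set.Iio 1))
      (nhds ((∑ k, m k : ℝ) : EReal)) := by
    refine (continuous_coe_real_ereal.tendsto _).comp (tendsto_nhdsWithin_of_tendsto_nhds ?_)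
    have : Tendsto (fun c : ℝ => c * ∑ k, m k) (nhds 1) (nhds (1 * ∑ k, m k)) :=
      tendsto_id.mul_const _
    rwa [one_mul] at this
  refine le_of_tendsto hlim ?_
  filter_upwards [Ioo_mem_nhdsLT (zero_lt_one' ℝ)] with c hc
  exact key c hc
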